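/- Let $V$ be a finite set. All directed graphs $\mathcal G=(V,E)$ below contain every self-loop $i\to i$, $i\in V$; a *DAG* is such a graph with no directed cycle of length greater than one. Self-loops are ignored for the parents $\mathrm{pa}(i)$, the children $\mathrm{ch}(i)$, the neighbors $\mathrm{ne}(i)=\mathrm{pa}(i)\cup\mathrm{ch}(i)$ and the skeleton (the underlying undirected simple graph). The (Lyapunov) *model* of $\mathcal G$ is $$\mathcal M_{\mathcal G}=\{\Sigma\in\mathbb R^{V\times V}\ \text{symmetric positive definite}:\ M\Sigma+\Sigma M^T+2I=0\ \text{for some stable } M\in\mathbb R^{V\times V}\text{ with } m_{ji}=0 \text{ whenever } i\to j\notin E\},$$ where stable means that all eigenvalues have strictly negative real part. For $k,i,j\in V$ write $k\perp\!\!\!\perp\{i,j\}$ if $\sigma_{ki}=\sigma_{kj}=0$ for all $\Sigma\in\mathcal M_{\mathcal G}$ (marginal independence in the centered Gaussian distributions with covariance matrix in the model). An edge $i\to j$, $i\ne j$, of a DAG $\mathcal G$ is *super-covered* if * $\mathrm{ch}(i)=\mathrm{ch}(j)\cup\{j\}$ and $\mathrm{pa}(i)\cup\{i\}=\mathrm{pa}(j)$;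 * $k\to l\in E$ for all $k\in\mathrm{pa}(j)$ and $l\in\mathrm{ch}(i)$; * for every $k\in V\setminus\{i,j\}$, either $k\in\mathrm{ne}(i)\cap\mathrm{ne}(j)$ or $k\perp\!\!\!\perp\{i,j\}$. A *super-covered edge flip* replaces a super-covered edge $i\to j$ of a DAG by $j\to i$. **Theorem.** Let $\mathcal G_1$ and $\mathcal G_2$ be two DAGs on the vertex set $V$, with $|V|\ge 4$, such that the induced subgraphs satisfy $\mathcal M_{\mathcal G_1[K]}=\mathcal M_{\mathcal G_2[K]}$ for every subset $K\subseteq V$ of size four. Then $\mathcal G_1$ and $\mathcal G_2$ have the same skeleton, and there exists a sequence of exactly $\delta=|E(\mathcal G_1)\setminus E(\mathcal G_2)|$ super-covered edge flips, passing only through DAGs, which transforms $\mathcal G_1$ into $\mathcal G_2$. In particular, $\mathcal M_{\mathcal G_1}=\mathcal M_{\mathcal G_2}$. -/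

import Mathlib

/-!
A directed graph on `V` is a `Digraph V`, and `G.Adj i j` means that `i → j` is an edge of `G`.
The self-loops `i → i` are genuine edges (they allow the diagonal of the drift matrix to be
nonzero); they are ignored by parents, children, neighbours, skeletons and acyclicity.
-/

namespace Lyapunov

section Graphs

variable {V : Type*}

/-- The edge set of `G`, self-loops included. -/
def edges (G : Digraph V) : Set (V × V) := {e | G.Adj e.1 e.2}

/-- A DAG: every self-loop is present and there is no directed cycle of length greater than one,
that is, no nonempty closed walk along non-loop edges. -/
def IsDAG (G : Digraph V) : Prop :=
  (∀ i, G.Adj i i) ∧ ∀ i, ¬ Relation.TransGen (fun a b => a ≠ b ∧ G.Adj a b) i i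

/-- The parents of `i`. -/
def pa (G : Digraph V) (i : V) : Set V := {k | k ≠ i ∧ G.Adj k i}

/-- The children of `i`. -/
def ch (G : Digraph V) (i : V) : Set V := {k | k ≠ i ∧ G.Adj i k}

/-- The neighbours of `i`. -/
def nbr (G : Digraph V) (i : V) : Set V := pa G i ∪ ch G i

/-- The skeleton of `G`: distinct `i`, `j` are joined iff `i → j` or `j → i` is an edge. -/
def skeleton (G : Digraph V) : SimpleGraph V := G.toSimpleGraphInclusive

/-- The induced subgraph `G[K]`, a directed graph with vertex set `K`. -/
def induce (G : Digraph V) (K : Finset V) : Digraph K where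
  Adj a b := G.Adj a b

/-- The graph obtained from `G` by replacing the edge `i → j` by `j → i`. -/
def flip (G : Digraph V) (i j : V) : Digraph V where
  Adj a b := (G.Adj a b ∧ ¬ (a = i ∧ b = j)) ∨ (a = j ∧ b = i)

end Graphs

section Models

variable {V : Type*} [Fintype V] [DecidableEq V]

/-- A real square matrix is stable if all its complex eigenvalues have negative real part. -/
def IsStable (M : Matrix V V ℝ) : Prop :=
  ∀ z ∈ spectrum ℂ (M.map (algebraMap ℝ ℂ)), z.re < 0

/-- The space `ℝ^E` of `G`-sparse matrices: `M j i = 0` whenever `i → j` is not an edge. -/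
def sparse (G : Digraph V) : Set (Matrix V V ℝ) := {M | ∀ i j, ¬ G.Adj i j → M j i = 0}

/-- The graphical continuous Lyapunov model of `G` with volatility matrix `C`, as a set of
covariance matrices. -/
def gclm (G : Digraph V) (C : Matrix V V ℝ) : Set (Matrix V V ℝ) :=
  {S | S.PosDef ∧ ∃ M ∈ sparse G, IsStable M ∧ M * S + S * M.transpose + C = 0}

/-- The model of `G`, with volatility matrix `2 I`. -/
def model (G : Digraph V) : Set (Matrix V V ℝ) := gclm G ((2 : ℝ) • (1 : Matrix V V ℝ))

/-- Marginal independence of `X k` and `(X i, X j)` in the model of `G`: for every centered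
Gaussian vector `X` with covariance matrix in the model, the covariances of `X k` with `X i`
and with `X j` vanish. -/
def MargIndep (G : Digraph V) (k i j : V) : Prop :=
  ∀ S ∈ model G, S k i = 0 ∧ S k j = 0

/-- `i → j` is a super-covered (non-loop) edge of `G`. -/
structure IsSuperCovered (G : Digraph V) (i j : V) : Prop where
  ne : i ≠ j
  adj : G.Adj i j
  ch_eq : ch G i = ch G j ∪ {j}
  pa_eq : pa G i ∪ {i} = pa G j
  pa_ch : ∀ k ∈ pa G j, ∀ l ∈ ch G i, G.Adj k l
  rest : ∀ k, k ≠ i → k ≠ j → k ∈ nbr G i ∩ nbr G j ∨ MargIndep G k i j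

/-- `G'` arises from the DAG `G` by flipping one super-covered edge. -/
def IsSuperCoveredFlip (G G' : Digraph V) : Prop :=
  IsDAG G ∧ ∃ i j, IsSuperCovered G i j ∧ G' = flip G i j

/-- A sequence of exactly `n` super-covered edge flips transforms `G₁` into `G₂`, all graphs in
the sequence being DAGs. -/
def TransformsInFlips (n : ℕ) (G₁ G₂ : Digraph V) : Prop :=
  ∃ H : Fin (n + 1) → Digraph V, H 0 = G₁ ∧ H (Fin.last n) = G₂ ∧
    (∀ t, IsDAG (H t)) ∧ ∀ t : Fin n, IsSuperCoveredFlip (H t.castSucc) (H t.succ)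

end Models

end Lyapunov

/-! Any solution of the Lyapunov equation with a positive definite covariance is automatically
stable (`isStable_of_lyapunov`), so for fixed `S` membership in a model is a linear problem in the
drift matrix. This serves in two directions.

Flips preserve models. Two drifts for the same `S` differ by an `N` with `N * S` skew-symmetric. For
a flippable edge `i → j`, a rank-two `N` supported on allowed entries removes the drift coefficient
of `i → j` at the cost of one for `j → i` (`model_subset_model_flip`).

Four vertices detect everything else. Explicit 4 × 4 covariances show that locally equivalent DAGs
have the same skeleton (`LocallyEquivalent.adj`) and orient every edge of an induced path of length
two in the same way (`adj_of_path`, `adj_of_path'`). Hence the endpoints of a reversed edge share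
their neighbours. If the edge spans the least level difference among reversed edges, no vertex lies
between its endpoints, so parents and children agree as well; four further covariances give the
remaining conditions (`Reversed.flippable`). Flipping this edge keeps local equivalence and lowers
the number of differing edges by exactly one, so induction on that number finishes the proof. -/

namespace Lyapunov

/-! ### The Lyapunov equation on a DAG: stability, triangularity, vanishing covariances. -/

section Lyapunov_equation

open Matrix

lemma isSymm_of_posDef {V : Type*} {S : Matrix V V ℝ} (hS : S.PosDef) : S.IsSymm := by
  have := hS.isHermitian
  simpa [IsHermitian, IsSymm, conjTranspose_eq_transpose_of_trivial] using this

variable {V : Type*} [Fintype V]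

lemma dotProduct_mulVec_comm_of_isSymm {S : Matrix V V ℝ} (hS : S.IsSymm) (x y : V → ℝ) :
    x ⬝ᵥ (S *ᵥ y) = y ⬝ᵥ (S *ᵥ x) := by
  rw [dotProduct_mulVec, ← mulVec_transpose, hS.eq, dotProduct_comm]

/-- The number of proper ancestors, a topological numbering of a DAG. -/
noncomputable def level (G : Digraph V) (b : V) : ℕ :=
  {a | Relation.TransGen (fun a b => a ≠ b ∧ G.Adj a b) a b}.ncard

lemma level_lt {G : Digraph V} (hG : IsDAG G) {a b : V} (hne : a ≠ b) (hab : G.Adj a b) :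
    level G a < level G b := by
  apply Set.ncard_lt_ncard _ (Set.toFinite _)
  refine ⟨fun c hc => hc.tail ⟨hne, hab⟩, fun hle => hG.2 a (hle ?_)⟩
  exact Relation.TransGen.single ⟨hne, hab⟩

lemma IsDAG.asymm {G : Digraph V} (hG : IsDAG G) {a b : V} (hne : a ≠ b) (hab : G.Adj a b) :
    ¬ G.Adj b a := fun hba =>
  lt_asymm (level_lt hG hne hab) (level_lt hG hne.symm hba)

lemma IsDAG.not_triangle {G : Digraph V} (hG : IsDAG G) {a b c : V} (h1 : a ≠ b) (h2 : b ≠ c)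
    (hab : G.Adj a b) (hbc : G.Adj b c) : ¬ G.Adj c a := fun hca => by
  have := level_lt hG h1 hab
  have := level_lt hG h2 hbc
  by_cases h3 : c = a
  · subst h3; omega
  · have := level_lt hG h3 hca
    omega

variable [DecidableEq V]

lemma dotProduct_mulVec_transpose_of_lyapunov {M S : Matrix V V ℝ} (hS : S.PosDef)
    (h : M * S + S * Mᵀ + (2 : ℝ) • (1 : Matrix V V ℝ) = 0) (x : V → ℝ) :
    x ⬝ᵥ (S *ᵥ (Mᵀ *ᵥ x)) = - (x ⬝ᵥ x) := by
  have h1 : x ⬝ᵥ ((M * S + S * Mᵀ + (2 : ℝ) • (1 : Matrix V V ℝ)) *ᵥ x) = 0 := by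
    rw [h]; simp
  have h2 : x ⬝ᵥ ((M * S) *ᵥ x) = x ⬝ᵥ (S *ᵥ (Mᵀ *ᵥ x)) := by
    rw [← mulVec_mulVec, dotProduct_mulVec, ← mulVec_transpose,
      dotProduct_mulVec_comm_of_isSymm (isSymm_of_posDef hS)]
  rw [add_mulVec, add_mulVec, dotProduct_add, dotProduct_add, h2, ← mulVec_mulVec,
    smul_mulVec, one_mulVec, dotProduct_smul, smul_eq_mul] at h1
  linarith

/-- A solution of the Lyapunov equation with positive definite `S` has a stable drift matrix. -/
lemma isStable_of_lyapunov {M S : Matrix V V ℝ} (hS : S.PosDef)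
    (h : M * S + S * Mᵀ + (2 : ℝ) • (1 : Matrix V V ℝ) = 0) : IsStable M := by
  intro z hz
  set N := M.map (algebraMap ℝ ℂ) with hN
  have hdet : (algebraMap ℂ (Matrix V V ℂ) z - N).det = 0 := by
    by_contra hne
    exact (spectrum.mem_iff.mp hz) ((Matrix.isUnit_iff_isUnit_det _).mpr (isUnit_iff_ne_zero.mpr hne))
  rw [← det_transpose] at hdet
  obtain ⟨w, hw0, hw⟩ := exists_mulVec_eq_zero_iff.mpr hdet
  have hw' : Nᵀ *ᵥ w = z • w := by
    rw [transpose_sub, sub_mulVec, sub_eq_zero, algebraMap_eq_diagonal, diagonal_transpose] at hw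
    rw [← hw]
    ext i
    simp [mulVec_diagonal]
  -- With `w = x + iy` an eigenvector of `Mᵀ`, the mixed terms cancel in the sum of the two
  -- quadratic identities: `Re z` times `xᵀSx + yᵀSy` equals `-(|x|² + |y|²)`.
  set x : V → ℝ := fun i => (w i).re with hx
  set y : V → ℝ := fun i => (w i).im with hy
  have hMx : Mᵀ *ᵥ x = z.re • x - z.im • y := by
    ext i
    have := congrArg Complex.re (congrFun hw' i)
    simpa [mulVec, dotProduct, hN, hx, hy] using this
  have hMy : Mᵀ *ᵥ y = z.re • y + z.im • x := by
    ext i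
    have := congrArg Complex.im (congrFun hw' i)
    simpa [mulVec, dotProduct, hN, hx, hy] using this
  have e1 := dotProduct_mulVec_transpose_of_lyapunov hS h x
  have e2 := dotProduct_mulVec_transpose_of_lyapunov hS h y
  rw [hMx, mulVec_sub, mulVec_smul, mulVec_smul, dotProduct_sub, dotProduct_smul,
    dotProduct_smul, smul_eq_mul, smul_eq_mul] at e1
  rw [hMy, mulVec_add, mulVec_smul, mulVec_smul, dotProduct_add, dotProduct_smul,
    dotProduct_smul, smul_eq_mul, smul_eq_mul,
    dotProduct_mulVec_comm_of_isSymm (isSymm_of_posDef hS) y x] at e2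
  have px : 0 ≤ x ⬝ᵥ (S *ᵥ x) := by simpa using hS.posSemidef.dotProduct_mulVec_nonneg x
  have py : 0 ≤ y ⬝ᵥ (S *ᵥ y) := by simpa using hS.posSemidef.dotProduct_mulVec_nonneg y
  have qx : 0 ≤ x ⬝ᵥ x := by simpa using dotProduct_star_self_nonneg x
  have qy : 0 ≤ y ⬝ᵥ y := by simpa using dotProduct_star_self_nonneg y
  have hpos : 0 < x ⬝ᵥ x + y ⬝ᵥ y := by
    refine lt_of_le_of_ne (by positivity) fun h0 => hw0 ?_
    have hx0 : x = 0 := dotProduct_self_eq_zero.mp (by linarith)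
    have hy0 : y = 0 := dotProduct_self_eq_zero.mp (by linarith)
    ext i
    exact Complex.ext (congrFun hx0 i) (congrFun hy0 i)
  by_contra hre
  push Not at hre
  nlinarith [mul_nonneg hre px, mul_nonneg hre py]

/-- Removes the spectral condition: what remains is linear in `M`. -/
lemma mem_model_iff {G : Digraph V} {S : Matrix V V ℝ} :
    S ∈ model G ↔ S.PosDef ∧ ∃ M ∈ sparse G,
      M * S + S * Mᵀ + (2 : ℝ) • (1 : Matrix V V ℝ) = 0 :=
  ⟨fun ⟨hS, M, hM, _, h⟩ => ⟨hS, M, hM, h⟩,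
    fun ⟨hS, M, hM, h⟩ => ⟨hS, M, hM, isStable_of_lyapunov hS h, h⟩⟩

/-- A sparse drift matrix of a DAG is triangular, so stability makes its diagonal negative. -/
lemma diag_neg {G : Digraph V} (hG : IsDAG G) {M : Matrix V V ℝ} (hM : M ∈ sparse G)
    (hs : IsStable M) (a : V) : M a a < 0 := by
  have key : (Matrix.scalar V (M a a) - M)ᵀ.det = 0 := by
    have hT : (Matrix.scalar V (M a a) - M)ᵀ.BlockTriangular (level G) := by
      intro b c hcb
      have hne : b ≠ c := by rintro rfl; exact lt_irrefl _ hcb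
      have : M c b = 0 := hM _ _ fun hbc => lt_asymm hcb (level_lt hG hne hbc)
      simp [this, hne.symm]
    rw [hT.det]
    -- No edge joins distinct vertices of equal level, so row `a` of its diagonal block is zero.
    refine Finset.prod_eq_zero (Finset.mem_image_of_mem _ (Finset.mem_univ a)) ?_
    refine Matrix.det_eq_zero_of_row_eq_zero ⟨a, rfl⟩ ?_
    rintro ⟨b, hb⟩
    by_cases hab : a = b
    · subst hab; simp [toSquareBlock, toSquareBlockProp]
    · have : M b a = 0 := hM _ _ fun h => (level_lt hG hab h).ne' hb
      simp [toSquareBlock, toSquareBlockProp, this, diagonal_apply_ne _ hab]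
  rw [det_transpose] at key
  have hmem : ((M a a : ℝ) : ℂ) ∈ spectrum ℂ (M.map (algebraMap ℝ ℂ)) := by
    rw [spectrum.mem_iff]
    intro hu
    have h1 := (Matrix.isUnit_iff_isUnit_det _).mp hu
    have h2 : algebraMap ℂ (Matrix V V ℂ) (M a a : ℝ) - M.map (algebraMap ℝ ℂ)
        = (algebraMap ℝ ℂ).mapMatrix (Matrix.scalar V (M a a) - M) := by
      ext i j
      by_cases hij : i = j
      · subst hij; simp [algebraMap_eq_diagonal]
      · simp [algebraMap_eq_diagonal, hij]
    rw [h2, ← RingHom.map_det, key] at h1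
    simp at h1
  simpa using hs _ hmem

lemma lyapunov_apply {M S : Matrix V V ℝ} (hS : S.IsSymm)
    (h : M * S + S * Mᵀ + (2 : ℝ) • (1 : Matrix V V ℝ) = 0) {a b : V} (hab : a ≠ b) :
    ∑ k, M a k * S k b + ∑ k, M b k * S k a = 0 := by
  have h1 := congrFun (congrFun h a) b
  simp only [Matrix.add_apply, mul_apply, Matrix.smul_apply, transpose_apply, one_apply_ne hab,
    smul_zero, add_zero, Matrix.zero_apply] at h1
  rw [← h1]
  congr 1
  exact Finset.sum_congr rfl fun k _ => by rw [mul_comm, hS.apply]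

/-- Covariances between disjoint parent-closed vertex sets vanish. -/
lemma apply_eq_zero_of_parent_closed {G : Digraph V} (hG : IsDAG G) {S : Matrix V V ℝ}
    (hS : S ∈ model G) {A R : Set V} (hA : ∀ k a, a ∈ A → G.Adj k a → k ∈ A)
    (hR : ∀ k r, r ∈ R → G.Adj k r → k ∈ R) (hAR : Disjoint A R) {a r : V} (ha : a ∈ A)
    (hr : r ∈ R) : S r a = 0 := by
  obtain ⟨hpd, M, hM, hst, hL⟩ := hS
  have hsymm := isSymm_of_posDef hpd
  induction hn : level G a + level G r using Nat.strong_induction_on generalizing a r with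
  | _ n ih =>
    -- In the `(a, r)` equation every other covariance has a smaller level sum and vanishes by
    -- induction, leaving `(M a a + M r r) * S r a = 0` with a negative factor.
    have hne : a ≠ r := fun h => (Set.disjoint_left.mp hAR ha) (h ▸ hr)
    have h := lyapunov_apply hsymm hL hne
    rw [Finset.sum_eq_single a, Finset.sum_eq_single r, hsymm.apply r a] at h
    · have := diag_neg hG hM hst a
      have := diag_neg hG hM hst r
      have h0 : (M a a + M r r) * S r a = 0 := by linarith
      exact (mul_eq_zero.mp h0).resolve_left (by linarith)
    · intro k _ hk
      by_cases hkr : G.Adj k r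
      · rw [ih _ (by have := level_lt hG hk hkr; omega) ha (hR k r hr hkr) rfl, mul_zero]
      · rw [hM _ _ hkr, zero_mul]
    · simp
    · intro k _ hk
      by_cases hka : G.Adj k a
      · rw [hsymm.apply, ih _ (by have := level_lt hG hk hka; omega) (hA k a ha hka) hr rfl,
          mul_zero]
      · rw [hM _ _ hka, zero_mul]
    · simp

end Lyapunov_equation

end Lyapunov

namespace Lyapunov

/-! ### Flippable edges: acyclicity and invariance of the model. -/

section Flips

open Matrix

variable {V : Type*}

/-- The graphical conditions that make the edge `i → j` super-covered. -/
structure Flippable (G : Digraph V) (i j : V) : Prop where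
  ne : i ≠ j
  adj : G.Adj i j
  pa_iff : ∀ k, k ≠ i → k ≠ j → (G.Adj k i ↔ G.Adj k j)
  ch_iff : ∀ k, k ≠ i → k ≠ j → (G.Adj i k ↔ G.Adj j k)
  pa_ch : ∀ p c, p ≠ i → p ≠ j → c ≠ i → c ≠ j → G.Adj p i → G.Adj i c → G.Adj p c
  not_adj_pa : ∀ p r, p ≠ i → p ≠ j → r ≠ i → r ≠ j → G.Adj p i → ¬ G.Adj r i → ¬ G.Adj i r →
    ¬ G.Adj p r ∧ ¬ G.Adj r p
  not_ch_adj : ∀ c r, c ≠ i → c ≠ j → r ≠ i → r ≠ j → G.Adj i c → ¬ G.Adj r i → ¬ G.Adj i r →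
    ¬ G.Adj c r

lemma flip_adj_of_ne {G : Digraph V} {i j a b : V} (h1 : ¬ (a = i ∧ b = j))
    (h2 : ¬ (a = j ∧ b = i)) : (flip G i j).Adj a b ↔ G.Adj a b := by
  simp only [flip, h2, or_false]
  exact and_iff_left h1

lemma flip_adj {G : Digraph V} {i j : V} : (flip G i j).Adj j i := by
  simp [flip]

lemma flip_flip {G : Digraph V} {i j : V} (h : i ≠ j) (h1 : G.Adj i j) (h2 : ¬ G.Adj j i) :
    flip (flip G i j) j i = G := by
  ext a b
  by_cases e1 : a = i ∧ b = j
  · obtain ⟨rfl, rfl⟩ := e1; simp [flip, h1]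
  by_cases e2 : a = j ∧ b = i
  · obtain ⟨rfl, rfl⟩ := e2; simp [flip, h2, h.symm]
  rw [flip_adj_of_ne e2 e1, flip_adj_of_ne e1 e2]

/-- The conditions are symmetric in the two endpoints, so a single inclusion of models yields
equality. -/
lemma Flippable.flip_symm {G : Digraph V} {i j : V} (h : Flippable G i j) :
    Flippable (flip G i j) j i := by
  have e1 : ∀ a b, a ≠ i → a ≠ j → ((flip G i j).Adj a b ↔ G.Adj a b) := fun a b h1 h2 =>
    flip_adj_of_ne (fun h => h1 h.1) (fun h => h2 h.1)
  have e2 : ∀ a b, b ≠ i → b ≠ j → ((flip G i j).Adj a b ↔ G.Adj a b) := fun a b h1 h2 =>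
    flip_adj_of_ne (fun h => h2 h.2) (fun h => h1 h.2)
  refine ⟨h.ne.symm, flip_adj, fun k hj hi => ?_, fun k hj hi => ?_,
    fun p c hpj hpi hcj hci => ?_, fun p r hpj hpi hrj hri => ?_, fun c r hcj hci hrj hri => ?_⟩
  · rw [e1 _ _ hi hj, e1 _ _ hi hj, h.pa_iff k hi hj]
  · rw [e2 _ _ hi hj, e2 _ _ hi hj, h.ch_iff k hi hj]
  · rw [e1 _ _ hpi hpj, e1 _ _ hpi hpj, e2 _ _ hci hcj, ← h.pa_iff p hpi hpj,
      ← h.ch_iff c hci hcj]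
    exact h.pa_ch p c hpi hpj hci hcj
  · rw [e1 _ _ hpi hpj, e1 _ _ hpi hpj, e1 _ _ hri hrj, e1 _ _ hri hrj, e2 _ _ hri hrj,
      ← h.pa_iff p hpi hpj, ← h.pa_iff r hri hrj, ← h.ch_iff r hri hrj]
    exact h.not_adj_pa p r hpi hpj hri hrj
  · rw [e2 _ _ hci hcj, e2 _ _ hri hrj, e2 _ _ hri hrj, e1 _ _ hri hrj,
      ← h.ch_iff c hci hcj, ← h.pa_iff r hri hrj, ← h.ch_iff r hri hrj]
    exact h.not_ch_adj c r hci hcj hri hrj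

/-- Exchanging the levels of `i` and `j` gives a topological numbering of the flipped graph. -/
lemma isDAG_flip [Fintype V] [DecidableEq V] {G : Digraph V} (hG : IsDAG G) {i j : V}
    (h : Flippable G i j) : IsDAG (flip G i j) := by
  refine ⟨fun a => ?_, fun a ha => ?_⟩
  · exact (flip_adj_of_ne (fun h' => h.ne (h'.1.symm.trans h'.2))
      (fun h' => h.ne (h'.2.symm.trans h'.1))).mpr (hG.1 a)
  · have hlt : ∀ a b, a ≠ b → (flip G i j).Adj a b →
        level G (Equiv.swap i j a) < level G (Equiv.swap i j b) := by
      rintro a b hab (⟨h1, h2⟩ | ⟨rfl, rfl⟩)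
      · by_cases hai : a = i
        · subst hai
          have hbj : b ≠ j := fun hb => h2 ⟨rfl, hb⟩
          rw [Equiv.swap_apply_left, Equiv.swap_apply_of_ne_of_ne hab.symm hbj]
          exact level_lt hG hbj.symm ((h.ch_iff b hab.symm hbj).mp h1)
        by_cases haj : a = j
        · subst haj
          have hbi : b ≠ i := by
            rintro rfl
            exact hG.asymm h.ne h.adj h1
          rw [Equiv.swap_apply_right, Equiv.swap_apply_of_ne_of_ne hbi hab.symm]
          exact level_lt hG hbi.symm ((h.ch_iff b hbi hab.symm).mpr h1)
        rw [Equiv.swap_apply_of_ne_of_ne hai haj]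
        by_cases hbi : b = i
        · subst hbi
          rw [Equiv.swap_apply_left]
          exact level_lt hG haj ((h.pa_iff a hai haj).mp h1)
        by_cases hbj : b = j
        · subst hbj
          rw [Equiv.swap_apply_right]
          exact level_lt hG hai ((h.pa_iff a hai haj).mpr h1)
        rw [Equiv.swap_apply_of_ne_of_ne hbi hbj]
        exact level_lt hG hab h1
      · rw [Equiv.swap_apply_left, Equiv.swap_apply_right]
        exact level_lt hG h.ne h.adj
    have hlt' : ∀ b, Relation.TransGen (fun a b => a ≠ b ∧ (flip G i j).Adj a b) a b →
        level G (Equiv.swap i j a) < level G (Equiv.swap i j b) := by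
      intro b hb
      induction hb with
      | single h => exact hlt _ _ h.1 h.2
      | tail _ h ih => exact ih.trans (hlt _ _ h.1 h.2)
    exact lt_irrefl _ (hlt' a ha)

variable [Fintype V] [DecidableEq V]

/-- The dual vectors of the coordinates in `A` with respect to a principal submatrix. -/
lemma exists_dual_vector {S : Matrix V V ℝ} (hS : S.PosDef) {A : Set V} {i : V} (hi : i ∈ A) :
    ∃ p : V → ℝ, (∀ k ∉ A, p k = 0) ∧ (∀ a ∈ A, (S *ᵥ p) a = if a = i then 1 else 0) ∧
      0 < p i := by
  classical
  let T : Matrix A A ℝ := S.submatrix (↑) (↑)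
  have hT : T.PosDef := hS.submatrix Subtype.val_injective
  have hTi : T⁻¹.PosDef := hT.inv
  have hmul : T * T⁻¹ = 1 := Matrix.mul_nonsing_inv _ ((isUnit_iff_isUnit_det _).mp hT.isUnit)
  -- Column `i` of the inverse of the principal submatrix on `A`, extended by zero.
  refine ⟨fun k => if h : k ∈ A then T⁻¹ ⟨k, h⟩ ⟨i, hi⟩ else 0, fun k hk => by simp [hk],
    fun a ha => ?_, by simpa [hi] using hTi.diag_pos⟩
  have h1 := congrFun (congrFun hmul ⟨a, ha⟩) ⟨i, hi⟩
  rw [mul_apply, one_apply] at h1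
  simp only [Subtype.mk.injEq] at h1
  rw [← h1, mulVec, dotProduct]
  refine (Finset.sum_of_injOn Subtype.val Subtype.val_injective.injOn (by simp) ?_ ?_).symm
  · intro k _ hk
    have : k ∉ A := fun h => hk ⟨⟨k, h⟩, by simp⟩
    simp [this]
  · intro k _
    simp [T]

/-- The vertices that are not adjacent to a flippable edge are independent of the edge and of its
parents. -/
lemma Flippable.apply_eq_zero {G : Digraph V} (hG : IsDAG G) {i j : V} (h : Flippable G i j)
    {S : Matrix V V ℝ} (hS : S ∈ model G) {a r : V} (ha : a = i ∨ a = j ∨ G.Adj a i)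
    (hri : r ≠ i) (hrj : r ≠ j) (h1 : ¬ G.Adj r i) (h2 : ¬ G.Adj i r) : S r a = 0 := by
  refine apply_eq_zero_of_parent_closed hG hS (A := {k | k = i ∨ k = j ∨ G.Adj k i})
    (R := {k | k ≠ i ∧ k ≠ j ∧ ¬ G.Adj k i ∧ ¬ G.Adj i k}) ?_ ?_ ?_ ha ⟨hri, hrj, h1, h2⟩
  · intro k a ha hka
    by_contra hk
    simp only [Set.mem_ofPred_eq, not_or] at hk ha
    obtain ⟨hki, hkj, hk'⟩ := hk
    by_cases hai : a = i
    · exact hk' (hai ▸ hka)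
    by_cases haj : a = j
    · exact hk' ((h.pa_iff k hki hkj).mpr (haj ▸ hka))
    have hai' : G.Adj a i := by tauto
    by_cases hik : G.Adj i k
    · exact hG.not_triangle (Ne.symm hki) (by rintro rfl; exact hk' hai') hik hka hai'
    · exact (h.not_adj_pa a k hai haj hki hkj hai' hk' hik).2 hka
  · rintro k r ⟨hri, hrj, h1, h2⟩ hkr
    refine ⟨?_, ?_, fun hki => ?_, fun hik => ?_⟩
    · rintro rfl; exact h2 hkr
    · rintro rfl; exact h2 ((h.ch_iff r hri hrj).mpr hkr)
    · by_cases hk : k = i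
      · subst hk; exact h2 hkr
      by_cases hk' : k = j
      · subst hk'; exact h2 ((h.ch_iff r hri hrj).mpr hkr)
      exact (h.not_adj_pa k r hk hk' hri hrj hki h1 h2).1 hkr
    · by_cases hk : k = i
      · subst hk; exact h2 hkr
      by_cases hk' : k = j
      · subst hk'; exact h2 ((h.ch_iff r hri hrj).mpr hkr)
      exact h.not_ch_adj k r hk hk' hri hrj hik h1 h2 hkr
  · rw [Set.disjoint_left]
    rintro k (rfl | rfl | hk) ⟨h1, h2, h3, h4⟩
    exacts [h1 rfl, h2 rfl, h3 hk]

/-- With `u = S p` and `v = S q`, the matrix `N = u qᵀ - v pᵀ` satisfies `N S = u vᵀ - v uᵀ`, which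
is skew, so adding multiples of `N` to the drift keeps the equation. Its columns live on `A`, its
rows on `i`, `j` and their common children: on `A` the vectors `u`, `v` are coordinate vectors, and
on non-neighbours they vanish by independence. -/
lemma model_subset_model_flip {G : Digraph V} (hG : IsDAG G) {i j : V} (h : Flippable G i j) :
    model G ⊆ model (flip G i j) := by
  intro S hS
  have hS' := hS
  set A : Set V := {k | k = i ∨ k = j ∨ G.Adj k i} with hA
  obtain ⟨hpd, M, hM, hst, hL⟩ := hS
  have hsymm := isSymm_of_posDef hpd
  have hiA : i ∈ A := Or.inl rfl
  have hjA : j ∈ A := Or.inr (Or.inl rfl)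
  obtain ⟨p, hp0, hp, hpi⟩ := exists_dual_vector hpd hiA
  obtain ⟨q, hq0, hq, -⟩ := exists_dual_vector hpd hjA
  set u := S *ᵥ p with hu
  set v := S *ᵥ q with hv
  have hR0 : ∀ (x : V → ℝ), (∀ k ∉ A, x k = 0) → ∀ r, r ≠ i → r ≠ j → ¬ G.Adj r i →
      ¬ G.Adj i r → (S *ᵥ x) r = 0 := by
    intro x hx r h1 h2 h3 h4
    refine Finset.sum_eq_zero fun k _ => ?_
    change S r k * x k = 0
    by_cases hk : k ∈ A
    · rw [h.apply_eq_zero hG hS' hk h1 h2 h3 h4, zero_mul]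
    · rw [hx k hk, mul_zero]
  set t := M j i / p i with ht
  refine mem_model_iff.mpr ⟨hpd, M + t • (vecMulVec u q - vecMulVec v p), ?_, ?_⟩
  · intro a b hab
    have happ : (M + t • (vecMulVec u q - vecMulVec v p)) b a
        = M b a + t * (u b * q a - v b * p a) := by
      simp [vecMulVec_apply]
    rw [happ]
    by_cases hij : a = i ∧ b = j
    · obtain ⟨rfl, rfl⟩ := hij
      rw [hp _ hjA, hq _ hjA, ht]
      simp only [h.ne.symm, if_false, if_true]
      field_simp
      ring
    have hab' : ¬ G.Adj a b := fun h' => hab (Or.inl ⟨h', hij⟩)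
    rw [hM a b hab', zero_add]
    by_cases ha : a ∈ A
    · have : u b = 0 ∧ v b = 0 := by
        have hbi : b ≠ i := by
          rintro rfl
          rcases ha with rfl | rfl | ha
          exacts [hab' (hG.1 _), hab flip_adj, hab' ha]
        have hbj : b ≠ j := by
          rintro rfl
          rcases ha with rfl | rfl | ha
          · exact hij ⟨rfl, rfl⟩
          · exact hab' (hG.1 _)
          · by_cases hai : a = i
            · exact hij ⟨hai, rfl⟩
            by_cases haj : a = b
            · subst haj; exact hab' (hG.1 _)
            exact hab' ((h.pa_iff a hai haj).mp ha)
        by_cases hbA : G.Adj b i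
        · have hb : b ∈ A := Or.inr (Or.inr hbA)
          rw [hp b hb, hq b hb, if_neg hbi, if_neg hbj]
          exact ⟨rfl, rfl⟩
        by_cases hib : G.Adj i b
        · exfalso
          rcases ha with rfl | rfl | ha
          · exact hab' hib
          · exact hab' ((h.ch_iff b hbi hbj).mp hib)
          · by_cases hai : a = i
            · subst hai; exact hab' hib
            by_cases haj : a = j
            · subst haj; exact hab' ((h.ch_iff b hbi hbj).mp hib)
            exact hab' (h.pa_ch a b hai haj hbi hbj ha hib)
        · exact ⟨hR0 p hp0 b hbi hbj hbA hib, hR0 q hq0 b hbi hbj hbA hib⟩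
      rw [this.1, this.2]; ring
    · rw [hp0 a ha, hq0 a ha]; ring
  · have e1 : (vecMulVec u q - vecMulVec v p) * S = vecMulVec u v - vecMulVec v u := by
      rw [sub_mul, vecMulVec_mul, vecMulVec_mul, ← mulVec_transpose, ← mulVec_transpose, hsymm.eq]
    have e2 : S * (vecMulVec u q - vecMulVec v p)ᵀ = vecMulVec v u - vecMulVec u v := by
      rw [transpose_sub, transpose_vecMulVec, transpose_vecMulVec, mul_sub, mul_vecMulVec,
        mul_vecMulVec]
    rw [transpose_add, transpose_smul, add_mul, mul_add, smul_mul_assoc, mul_smul_comm, e1, e2]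
    rw [← hL, ← neg_sub (vecMulVec u v), smul_neg]
    abel

lemma model_flip {G : Digraph V} (hG : IsDAG G) {i j : V} (h : Flippable G i j) :
    model (flip G i j) = model G := by
  refine Set.Subset.antisymm ?_ (model_subset_model_flip hG h)
  have := model_subset_model_flip (isDAG_flip hG h) h.flip_symm
  rwa [flip_flip h.ne h.adj (hG.asymm h.ne h.adj)] at this

lemma Flippable.isSuperCovered {G : Digraph V} (hG : IsDAG G) {i j : V} (h : Flippable G i j) :
    IsSuperCovered G i j := by
  have hji := hG.asymm h.ne h.adj
  refine ⟨h.ne, h.adj, ?_, ?_, ?_, ?_⟩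
  · ext k
    by_cases hi : k = i
    · subst hi; simp [ch, hji, h.ne]
    by_cases hj : k = j
    · subst hj; simp [ch, h.adj, hi]
    · simp [ch, h.ch_iff k hi hj, hi, hj]
  · ext k
    by_cases hi : k = i
    · subst hi; simp [pa, h.adj, h.ne]
    by_cases hj : k = j
    · subst hj; simp [pa, hji, hi]
    · simp [pa, h.pa_iff k hi hj, hi, hj]
  · rintro k ⟨hkj, hk⟩ l ⟨hli, hl⟩
    by_cases hki : k = i
    · subst hki; exact hl
    by_cases hlj : l = j
    · subst hlj; exact hk
    exact h.pa_ch k l hki hkj hli hlj ((h.pa_iff k hki hkj).mpr hk) hl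
  · intro k hki hkj
    by_cases h1 : G.Adj k i
    · exact Or.inl ⟨Or.inl ⟨hki, h1⟩, Or.inl ⟨hkj, (h.pa_iff k hki hkj).mp h1⟩⟩
    by_cases h2 : G.Adj i k
    · exact Or.inl ⟨Or.inr ⟨hki, h2⟩, Or.inr ⟨hkj, (h.ch_iff k hki hkj).mp h2⟩⟩
    exact Or.inr fun S hS => ⟨h.apply_eq_zero hG hS (Or.inl rfl) hki hkj h1 h2,
      h.apply_eq_zero hG hS (Or.inr (Or.inl rfl)) hki hkj h1 h2⟩

end Flips
end Lyapunov

namespace Lyapunov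

/-! ### Explicit covariances separating graphs on four vertices. -/

section Four_vertices

open Matrix

lemma forall_fin_four {P : Fin 4 → Prop} : (∀ i, P i) ↔ P 0 ∧ P 1 ∧ P 2 ∧ P 3 :=
  ⟨fun h => ⟨h 0, h 1, h 2, h 3⟩, fun ⟨h0, h1, h2, h3⟩ i => by fin_cases i <;> assumption⟩

lemma lyapunov_iff {M S : Matrix (Fin 4) (Fin 4) ℝ} :
    M * S + S * Mᵀ + (2 : ℝ) • (1 : Matrix (Fin 4) (Fin 4) ℝ) = 0 ↔ ∀ a b,
      ∑ k, M a k * S k b + ∑ k, S a k * M b k + (if a = b then 2 else 0) = 0 := by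
  rw [← Matrix.ext_iff]
  simp only [Matrix.add_apply, Matrix.mul_apply, Matrix.smul_apply, transpose_apply, one_apply,
    smul_eq_mul, mul_ite, mul_one, mul_zero, Matrix.zero_apply]

/-- The factorization `S = Cᵀ D C`, with `C` unit triangular and `D` positive, certifies positive
definiteness by arithmetic alone. -/
lemma mem_model_of_ldl {H : Digraph (Fin 4)} {S : Matrix (Fin 4) (Fin 4) ℝ}
    (M C : Matrix (Fin 4) (Fin 4) ℝ) (d : Fin 4 → ℝ) (hd : ∀ i, 0 < d i) (hC : C.IsUpperTriangular)
    (hC1 : ∀ i, C i i = 1) (hS : ∀ a b, ∑ k, C k a * d k * C k b = S a b) (hM : M ∈ sparse H)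
    (hL : ∀ a b, ∑ k, M a k * S k b + ∑ k, S a k * M b k + (if a = b then 2 else 0) = 0) :
    S ∈ model H := by
  refine mem_model_iff.mpr ⟨?_, M, hM, lyapunov_iff.mpr hL⟩
  have hS' : Cᵀ * diagonal d * C = S := by
    ext a b
    rw [Matrix.mul_apply, ← hS]
    simp [mul_diagonal]
  have hdet : C.det ≠ 0 := by simp [det_of_isUpperTriangular hC, hC1]
  have h := (PosDef.diagonal hd).conjTranspose_mul_mul_same (B := C)
    (mulVec_injective_iff_isUnit.mpr ((isUnit_iff_isUnit_det _).mpr (isUnit_iff_ne_zero.mpr hdet)))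
  rwa [conjTranspose_eq_transpose_of_trivial, hS'] at h

lemma mem_model_of_edge {H : Digraph (Fin 4)} (hl : ∀ i, H.Adj i i)
    (h01 : H.Adj 0 1) :
    !![1, 1, 0, 0; 1, 3, 0, 0; 0, 0, 1, 0; 0, 0, 0, 1] ∈ model H := by
  refine mem_model_of_ldl !![-1, 0, 0, 0; 2, -1, 0, 0; 0, 0, -1, 0; 0, 0, 0, -1]
    !![1, 1, 0, 0; 0, 1, 0, 0; 0, 0, 1, 0; 0, 0, 0, 1] ![1, 2, 1, 1]
    ?_ ?_ ?_ ?_ ?_ ?_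
  · simp [forall_fin_four]
  · simp [IsUpperTriangular, BlockTriangular, forall_fin_four]
  · simp [forall_fin_four]
  · simp only [forall_fin_four, Fin.sum_univ_four]
    simp
    norm_num
  · simp only [sparse, Set.mem_ofPred_eq, forall_fin_four]
    simp [hl, h01]
  · simp only [forall_fin_four, Fin.sum_univ_four]
    simp
    norm_num

/-- The diagonal equations force `M 0 0 = -1` and `M 1 1 = -1/3`, while the `(0, 1)` equation
demands that their sum vanish. Vertices uncorrelated with the rest of `S` are padding: drift
coefficients out of them drop out of the other equations. -/
lemma not_mem_model_edge_nonedge {H : Digraph (Fin 4)}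
    (n01 : ¬ H.Adj 0 1) (n10 : ¬ H.Adj 1 0) :
    !![1, 1, 0, 0; 1, 3, 0, 0; 0, 0, 1, 0; 0, 0, 0, 1] ∉ model H := by
  intro hS
  obtain ⟨-, M, hM, hL⟩ := mem_model_iff.mp hS
  have e := lyapunov_iff.mp hL
  have e00 := e 0 0
  have e01 := e 0 1
  have e02 := e 0 2
  have e03 := e 0 3
  have e11 := e 1 1
  have e12 := e 1 2
  have e13 := e 1 3
  have e22 := e 2 2
  have e23 := e 2 3
  have e33 := e 3 3
  simp [Fin.sum_univ_four, hM _ _ n01, hM _ _ n10] at e00 e01 e02 e03 e11 e12 e13 e22 e23 e33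
  linarith

lemma mem_model_of_chain {H : Digraph (Fin 4)} (hl : ∀ i, H.Adj i i)
    (h01 : H.Adj 0 1) (h12 : H.Adj 1 2) :
    !![1, 1, 1, 0; 1, 3, 4, 0; 1, 4, 9, 0; 0, 0, 0, 1] ∈ model H := by
  refine mem_model_of_ldl !![-1, 0, 0, 0; 2, -1, 0, 0; 0, 2, -1, 0; 0, 0, 0, -1]
    !![1, 1, 1, 0; 0, 1, 3/2, 0; 0, 0, 1, 0; 0, 0, 0, 1] ![1, 2, 7/2, 1]
    ?_ ?_ ?_ ?_ ?_ ?_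
  · simp [forall_fin_four]
  · simp [IsUpperTriangular, BlockTriangular, forall_fin_four]
  · simp [forall_fin_four]
  · simp only [forall_fin_four, Fin.sum_univ_four]
    simp
    norm_num
  · simp only [sparse, Set.mem_ofPred_eq, forall_fin_four]
    simp [hl, h01, h12]
  · simp only [forall_fin_four, Fin.sum_univ_four]
    simp
    norm_num

/-- The ends of a collider are uncorrelated: `(M 0 0 + M 2 2) * S 0 2 = 0` with both diagonal
entries negative, although `S 0 2 = 1`. -/
lemma not_mem_model_chain_collider {H : Digraph (Fin 4)}
    (n10 : ¬ H.Adj 1 0) (n12 : ¬ H.Adj 1 2) (n02 : ¬ H.Adj 0 2) (n20 : ¬ H.Adj 2 0) :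
    !![1, 1, 1, 0; 1, 3, 4, 0; 1, 4, 9, 0; 0, 0, 0, 1] ∉ model H := by
  intro hS
  obtain ⟨-, M, hM, hL⟩ := mem_model_iff.mp hS
  have e := lyapunov_iff.mp hL
  have e00 := e 0 0
  have e01 := e 0 1
  have e02 := e 0 2
  have e03 := e 0 3
  have e11 := e 1 1
  have e12 := e 1 2
  have e13 := e 1 3
  have e22 := e 2 2
  have e23 := e 2 3
  have e33 := e 3 3
  simp [Fin.sum_univ_four, hM _ _ n10, hM _ _ n12, hM _ _ n02, hM _ _ n20]
    at e00 e01 e02 e03 e11 e12 e13 e22 e23 e33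
  linarith

/-- `M 2 2` is fixed by the `(2, 2)` equation; then row 0 is determined by `(0, 0)` and `(0, 2)`,
row 1 by `(1, 1)` and `(1, 2)`, and these values violate `(0, 1)`. -/
lemma not_mem_model_chain_reversed_chain {H : Digraph (Fin 4)}
    (n01 : ¬ H.Adj 0 1) (n12 : ¬ H.Adj 1 2) (n02 : ¬ H.Adj 0 2) (n20 : ¬ H.Adj 2 0) :
    !![1, 1, 1, 0; 1, 3, 4, 0; 1, 4, 9, 0; 0, 0, 0, 1] ∉ model H := by
  intro hS
  obtain ⟨-, M, hM, hL⟩ := mem_model_iff.mp hS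
  have e := lyapunov_iff.mp hL
  have e00 := e 0 0
  have e01 := e 0 1
  have e02 := e 0 2
  have e03 := e 0 3
  have e11 := e 1 1
  have e12 := e 1 2
  have e13 := e 1 3
  have e22 := e 2 2
  have e23 := e 2 3
  have e33 := e 3 3
  simp [Fin.sum_univ_four, hM _ _ n01, hM _ _ n12, hM _ _ n02, hM _ _ n20]
    at e00 e01 e02 e03 e11 e12 e13 e22 e23 e33
  linarith

lemma mem_model_of_fork {H : Digraph (Fin 4)} (hl : ∀ i, H.Adj i i)
    (h10 : H.Adj 1 0) (h12 : H.Adj 1 2) :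
    !![3, 1, 2, 0; 1, 1, 1, 0; 2, 1, 3, 0; 0, 0, 0, 1] ∈ model H := by
  refine mem_model_of_ldl !![-1, 2, 0, 0; 0, -1, 0, 0; 0, 2, -1, 0; 0, 0, 0, -1]
    !![1, 1/3, 2/3, 0; 0, 1, 1/2, 0; 0, 0, 1, 0; 0, 0, 0, 1] ![3, 2/3, 3/2, 1]
    ?_ ?_ ?_ ?_ ?_ ?_
  · simp [forall_fin_four]
  · simp [IsUpperTriangular, BlockTriangular, forall_fin_four]
  · simp [forall_fin_four]
  · simp only [forall_fin_four, Fin.sum_univ_four]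
    simp
    norm_num
  · simp only [sparse, Set.mem_ofPred_eq, forall_fin_four]
    simp [hl, h10, h12]
  · simp only [forall_fin_four, Fin.sum_univ_four]
    simp
    norm_num

lemma not_mem_model_fork_collider {H : Digraph (Fin 4)}
    (n10 : ¬ H.Adj 1 0) (n12 : ¬ H.Adj 1 2) (n02 : ¬ H.Adj 0 2) (n20 : ¬ H.Adj 2 0) :
    !![3, 1, 2, 0; 1, 1, 1, 0; 2, 1, 3, 0; 0, 0, 0, 1] ∉ model H := by
  intro hS
  obtain ⟨-, M, hM, hL⟩ := mem_model_iff.mp hS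
  have e := lyapunov_iff.mp hL
  have e00 := e 0 0
  have e01 := e 0 1
  have e02 := e 0 2
  have e03 := e 0 3
  have e11 := e 1 1
  have e12 := e 1 2
  have e13 := e 1 3
  have e22 := e 2 2
  have e23 := e 2 3
  have e33 := e 3 3
  simp [Fin.sum_univ_four, hM _ _ n10, hM _ _ n12, hM _ _ n02, hM _ _ n20]
    at e00 e01 e02 e03 e11 e12 e13 e22 e23 e33
  linarith

lemma not_mem_model_fork_reversed_chain {H : Digraph (Fin 4)}
    (n01 : ¬ H.Adj 0 1) (n12 : ¬ H.Adj 1 2) (n02 : ¬ H.Adj 0 2) (n20 : ¬ H.Adj 2 0) :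
    !![3, 1, 2, 0; 1, 1, 1, 0; 2, 1, 3, 0; 0, 0, 0, 1] ∉ model H := by
  intro hS
  obtain ⟨-, M, hM, hL⟩ := mem_model_iff.mp hS
  have e := lyapunov_iff.mp hL
  have e00 := e 0 0
  have e01 := e 0 1
  have e02 := e 0 2
  have e03 := e 0 3
  have e11 := e 1 1
  have e12 := e 1 2
  have e13 := e 1 3
  have e22 := e 2 2
  have e23 := e 2 3
  have e33 := e 3 3
  simp [Fin.sum_univ_four, hM _ _ n01, hM _ _ n12, hM _ _ n02, hM _ _ n20]
    at e00 e01 e02 e03 e11 e12 e13 e22 e23 e33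
  linarith

/-- In this and the later witnesses 0 and 1 are the ends of the reversed edge. Coefficients are
tuned so that some covariances vanish by cancellation between directed paths, here `S 1 3`; the
flipped graph cannot reproduce this. -/
lemma mem_model_of_grandparent {H : Digraph (Fin 4)} (hl : ∀ i, H.Adj i i)
    (h01 : H.Adj 0 1) (h20 : H.Adj 2 0) (h21 : H.Adj 2 1) (h32 : H.Adj 3 2) :
    !![9, 6, 4, 1; 6, 11, 1, 0; 4, 1, 3, 1; 1, 0, 1, 1] ∈ model H := by
  refine mem_model_of_ldl !![-1, 0, 2, 0; 2, -1, -2, 0; 0, 0, -1, 2; 0, 0, 0, -1]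
    !![1, 2/3, 4/9, 1/9; 0, 1, -5/21, -2/21; 0, 0, 1, 25/52; 0, 0, 0, 1] ![9, 7, 52/63, 33/52]
    ?_ ?_ ?_ ?_ ?_ ?_
  · simp [forall_fin_four]
  · simp [IsUpperTriangular, BlockTriangular, forall_fin_four]
  · simp [forall_fin_four]
  · simp only [forall_fin_four, Fin.sum_univ_four]
    simp
    norm_num
  · simp only [sparse, Set.mem_ofPred_eq, forall_fin_four]
    simp [hl, h01, h20, h21, h32]
  · simp only [forall_fin_four, Fin.sum_univ_four]
    simp
    norm_num

/-- Since `S 1 3 = 0`, the `(1, 3)` equation gives `M 1 2 = 0`; then `(1, 2)` reads `M 1 1 + M 2 2 =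
0`, but both are negative. -/
lemma not_mem_model_grandparent_flip {H : Digraph (Fin 4)}
    (n01 : ¬ H.Adj 0 1) (n02 : ¬ H.Adj 0 2) (n03 : ¬ H.Adj 0 3) (n12 : ¬ H.Adj 1 2)
    (n13 : ¬ H.Adj 1 3) (n23 : ¬ H.Adj 2 3) (n30 : ¬ H.Adj 3 0) (n31 : ¬ H.Adj 3 1) :
    !![9, 6, 4, 1; 6, 11, 1, 0; 4, 1, 3, 1; 1, 0, 1, 1] ∉ model H := by
  intro hS
  obtain ⟨-, M, hM, hL⟩ := mem_model_iff.mp hS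
  have e := lyapunov_iff.mp hL
  have e00 := e 0 0
  have e01 := e 0 1
  have e02 := e 0 2
  have e03 := e 0 3
  have e11 := e 1 1
  have e12 := e 1 2
  have e13 := e 1 3
  have e22 := e 2 2
  have e23 := e 2 3
  have e33 := e 3 3
  simp [Fin.sum_univ_four, hM _ _ n01, hM _ _ n02, hM _ _ n03, hM _ _ n12, hM _ _ n13, hM _ _ n23,
    hM _ _ n30, hM _ _ n31]
    at e00 e01 e02 e03 e11 e12 e13 e22 e23 e33
  linarith

lemma mem_model_of_parent_fork {H : Digraph (Fin 4)} (hl : ∀ i, H.Adj i i)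
    (h01 : H.Adj 0 1) (h20 : H.Adj 2 0) (h21 : H.Adj 2 1) (h23 : H.Adj 2 3) :
    !![3, 2, 1, 2; 2, 5, 0, 1; 1, 0, 1, 1; 2, 1, 1, 3] ∈ model H := by
  refine mem_model_of_ldl !![-1, 0, 2, 0; 2, -1, -2, 0; 0, 0, -1, 0; 0, 0, 2, -1]
    !![1, 2/3, 1/3, 2/3; 0, 1, -2/11, -1/11; 0, 0, 1, 1/2; 0, 0, 0, 1] ![3, 11/3, 6/11, 3/2]
    ?_ ?_ ?_ ?_ ?_ ?_
  · simp [forall_fin_four]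
  · simp [IsUpperTriangular, BlockTriangular, forall_fin_four]
  · simp [forall_fin_four]
  · simp only [forall_fin_four, Fin.sum_univ_four]
    simp
    norm_num
  · simp only [sparse, Set.mem_ofPred_eq, forall_fin_four]
    simp [hl, h01, h20, h21, h23]
  · simp only [forall_fin_four, Fin.sum_univ_four]
    simp
    norm_num

/-- Since `S 1 2 = 0`, the `(1, 2)` equation gives `M 1 2 = 0`; then `(1, 3)` reads `M 1 1 + M 3 3 =
0`, but both are negative. -/
lemma not_mem_model_parent_fork_flip {H : Digraph (Fin 4)}
    (n01 : ¬ H.Adj 0 1) (n02 : ¬ H.Adj 0 2) (n03 : ¬ H.Adj 0 3) (n12 : ¬ H.Adj 1 2)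
    (n13 : ¬ H.Adj 1 3) (n30 : ¬ H.Adj 3 0) (n31 : ¬ H.Adj 3 1) (n32 : ¬ H.Adj 3 2) :
    !![3, 2, 1, 2; 2, 5, 0, 1; 1, 0, 1, 1; 2, 1, 1, 3] ∉ model H := by
  intro hS
  obtain ⟨-, M, hM, hL⟩ := mem_model_iff.mp hS
  have e := lyapunov_iff.mp hL
  have e00 := e 0 0
  have e01 := e 0 1
  have e02 := e 0 2
  have e03 := e 0 3
  have e11 := e 1 1
  have e12 := e 1 2
  have e13 := e 1 3
  have e22 := e 2 2
  have e23 := e 2 3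
  have e33 := e 3 3
  simp [Fin.sum_univ_four, hM _ _ n01, hM _ _ n02, hM _ _ n03, hM _ _ n12, hM _ _ n13, hM _ _ n30,
    hM _ _ n31, hM _ _ n32]
    at e00 e01 e02 e03 e11 e12 e13 e22 e23 e33
  linarith

lemma mem_model_of_child_chain {H : Digraph (Fin 4)} (hl : ∀ i, H.Adj i i)
    (h01 : H.Adj 0 1) (h02 : H.Adj 0 2) (h12 : H.Adj 1 2) (h23 : H.Adj 2 3) :
    !![1, 1, 0, 0; 1, 3, -1, -1; 0, -1, 1, 1; 0, -1, 1, 3] ∈ model H := by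
  refine mem_model_of_ldl !![-1, 0, 0, 0; 2, -1, 0, 0; 2, -2, -3, 0; 0, 0, 2, -1]
    !![1, 1, 0, 0; 0, 1, -1/2, -1/2; 0, 0, 1, 1; 0, 0, 0, 1] ![1, 2, 1/2, 2]
    ?_ ?_ ?_ ?_ ?_ ?_
  · simp [forall_fin_four]
  · simp [IsUpperTriangular, BlockTriangular, forall_fin_four]
  · simp [forall_fin_four]
  · simp only [forall_fin_four, Fin.sum_univ_four]
    simp
    norm_num
  · simp only [sparse, Set.mem_ofPred_eq, forall_fin_four]
    simp [hl, h01, h02, h12, h23]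
  · simp only [forall_fin_four, Fin.sum_univ_four]
    simp
    norm_num

/-- The equations on 0 and 1 force `M 0 1 = 2/3`, whereas `S 0 2 = S 0 3 = 0` turns the `(0, 3)`
equation into `M 0 1 = 0`. -/
lemma not_mem_model_child_chain_flip {H : Digraph (Fin 4)}
    (n01 : ¬ H.Adj 0 1) (n03 : ¬ H.Adj 0 3) (n13 : ¬ H.Adj 1 3) (n20 : ¬ H.Adj 2 0)
    (n21 : ¬ H.Adj 2 1) (n30 : ¬ H.Adj 3 0) (n31 : ¬ H.Adj 3 1) :
    !![1, 1, 0, 0; 1, 3, -1, -1; 0, -1, 1, 1; 0, -1, 1, 3] ∉ model H := by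
  intro hS
  obtain ⟨-, M, hM, hL⟩ := mem_model_iff.mp hS
  have e := lyapunov_iff.mp hL
  have e00 := e 0 0
  have e01 := e 0 1
  have e02 := e 0 2
  have e03 := e 0 3
  have e11 := e 1 1
  have e12 := e 1 2
  have e13 := e 1 3
  have e22 := e 2 2
  have e23 := e 2 3
  have e33 := e 3 3
  simp [Fin.sum_univ_four, hM _ _ n01, hM _ _ n03, hM _ _ n13, hM _ _ n20, hM _ _ n21, hM _ _ n30,
    hM _ _ n31]
    at e00 e01 e02 e03 e11 e12 e13 e22 e23 e33
  linarith

lemma mem_model_of_parent_child {H : Digraph (Fin 4)} (hl : ∀ i, H.Adj i i)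
    (h01 : H.Adj 0 1) (h20 : H.Adj 2 0) (h21 : H.Adj 2 1) (h03 : H.Adj 0 3) (h13 : H.Adj 1 3) :
    !![3, 3, 1, 0; 3, 5, 1, -1; 1, 1, 1, 0; 0, -1, 0, 1] ∈ model H := by
  refine mem_model_of_ldl !![-1, 0, 2, 0; 1, -1, 1, 0; 0, 0, -1, 0; 2, -2, 0, -3]
    !![1, 1, 1/3, 0; 0, 1, 0, -1/2; 0, 0, 1, 0; 0, 0, 0, 1] ![3, 2, 2/3, 1/2]
    ?_ ?_ ?_ ?_ ?_ ?_
  · simp [forall_fin_four]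
  · simp [IsUpperTriangular, BlockTriangular, forall_fin_four]
  · simp [forall_fin_four]
  · simp only [forall_fin_four, Fin.sum_univ_four]
    simp
    norm_num
  · simp only [sparse, Set.mem_ofPred_eq, forall_fin_four]
    simp [hl, h01, h20, h21, h03, h13]
  · simp only [forall_fin_four, Fin.sum_univ_four]
    simp
    norm_num

/-- Since `S 0 3 = S 2 3 = 0`, the `(2, 3)` and `(0, 3)` equations give `M 0 1 = 0`. The equations
on 0, 1, 2 then determine rows 0 and 1 except that `(0, 1)` fails. -/
lemma not_mem_model_parent_child_flip {H : Digraph (Fin 4)}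
    (n01 : ¬ H.Adj 0 1) (n02 : ¬ H.Adj 0 2) (n12 : ¬ H.Adj 1 2) (n23 : ¬ H.Adj 2 3)
    (n30 : ¬ H.Adj 3 0) (n31 : ¬ H.Adj 3 1) (n32 : ¬ H.Adj 3 2) :
    !![3, 3, 1, 0; 3, 5, 1, -1; 1, 1, 1, 0; 0, -1, 0, 1] ∉ model H := by
  intro hS
  obtain ⟨-, M, hM, hL⟩ := mem_model_iff.mp hS
  have e := lyapunov_iff.mp hL
  have e00 := e 0 0
  have e01 := e 0 1
  have e02 := e 0 2
  have e03 := e 0 3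
  have e11 := e 1 1
  have e12 := e 1 2
  have e13 := e 1 3
  have e22 := e 2 2
  have e23 := e 2 3
  have e33 := e 3 3
  simp [Fin.sum_univ_four, hM _ _ n01, hM _ _ n02, hM _ _ n12, hM _ _ n23, hM _ _ n30, hM _ _ n31,
    hM _ _ n32]
    at e00 e01 e02 e03 e11 e12 e13 e22 e23 e33
  linarith

end Four_vertices
end Lyapunov

namespace Lyapunov

/-! ### Passing between four-vertex subgraphs and the whole graph. -/

section Local_equivalence

open Matrix

/-- The pullback of a directed graph along a map of vertices. -/
def pull {W V : Type*} (f : W → V) (G : Digraph V) : Digraph W where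
  Adj a b := G.Adj (f a) (f b)

lemma submatrix_mem_model_pull {W U : Type*} [Fintype W] [DecidableEq W] [Fintype U]
    [DecidableEq U] (e : W ≃ U) {H : Digraph U} {S : Matrix U U ℝ} (hS : S ∈ model H) :
    S.submatrix e e ∈ model (pull e H) := by
  obtain ⟨hpd, M, hM, hL⟩ := mem_model_iff.mp hS
  refine mem_model_iff.mpr ⟨hpd.submatrix e.injective, M.submatrix e e, fun i j h => hM _ _ h, ?_⟩
  have h := congrArg (fun X => X.submatrix e e) hL
  simpa [Matrix.submatrix_add, submatrix_mul_equiv, submatrix_smul] using h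

lemma model_pull_subset {W U : Type*} [Fintype W] [DecidableEq W] [Fintype U] [DecidableEq U]
    (e : W ≃ U) {H₁ H₂ : Digraph U} (h : model H₁ = model H₂) :
    model (pull e H₁) ⊆ model (pull e H₂) := by
  intro S hS
  have h1 : S.submatrix e.symm e.symm ∈ model H₁ := by
    have := submatrix_mem_model_pull e.symm hS
    convert this using 2
    ext a b
    simp [pull]
  have := submatrix_mem_model_pull e (h ▸ h1)
  simpa using this

lemma IsDAG.pull {W V : Type*} {G : Digraph V} (hG : IsDAG G) {f : W → V}
    (hf : Function.Injective f) : IsDAG (pull f G) := by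
  refine ⟨fun i => hG.1 _, fun i hi => hG.2 (f i) ?_⟩
  exact Relation.TransGen.lift (p := fun a b => a ≠ b ∧ G.Adj a b) f
    (fun a b h => ⟨fun he => h.1 (hf he), h.2⟩) _ _ hi

lemma Flippable.pull {W V : Type*} {G : Digraph V} {f : W → V} (hf : Function.Injective f)
    {a b : W} (h : Flippable G (f a) (f b)) : Flippable (pull f G) a b where
  ne := fun he => h.ne (congrArg f he)
  adj := h.adj
  pa_iff _ h1 h2 := h.pa_iff _ (hf.ne h1) (hf.ne h2)
  ch_iff _ h1 h2 := h.ch_iff _ (hf.ne h1) (hf.ne h2)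
  pa_ch _ _ h1 h2 h3 h4 := h.pa_ch _ _ (hf.ne h1) (hf.ne h2) (hf.ne h3) (hf.ne h4)
  not_adj_pa _ _ h1 h2 h3 h4 := h.not_adj_pa _ _ (hf.ne h1) (hf.ne h2) (hf.ne h3) (hf.ne h4)
  not_ch_adj _ _ h1 h2 h3 h4 := h.not_ch_adj _ _ (hf.ne h1) (hf.ne h2) (hf.ne h3) (hf.ne h4)

/-- Equality of the models of all induced subgraphs on four vertices. -/
def LocallyEquivalent {V : Type*} (G₁ G₂ : Digraph V) : Prop :=
  ∀ f : Fin 4 → V, Function.Injective f → model (pull f G₁) = model (pull f G₂)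

variable {V : Type*}

lemma LocallyEquivalent.symm {G₁ G₂ : Digraph V} (h : LocallyEquivalent G₁ G₂) :
    LocallyEquivalent G₂ G₁ := fun f hf => (h f hf).symm

/-- Labelling the vertices of `K` by `Fin 4` makes the explicit matrices applicable. -/
lemma locallyEquivalent_of_induce [DecidableEq V] {G₁ G₂ : Digraph V}
    (hK : ∀ K : Finset V, K.card = 4 → model (induce G₁ K) = model (induce G₂ K)) :
    LocallyEquivalent G₁ G₂ := by
  intro f hf
  let K : Finset V := Finset.univ.map ⟨f, hf⟩
  have h := hK K (by simp [K])
  let e : Fin 4 ≃ K := Equiv.ofBijective (fun a => ⟨f a, by simp [K]⟩)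
    ⟨fun a b hab => hf (congrArg Subtype.val hab), fun ⟨b, hb⟩ => by
      obtain ⟨a, -, rfl⟩ := Finset.mem_map.mp hb
      exact ⟨a, rfl⟩⟩
  exact (model_pull_subset e h).antisymm (model_pull_subset e h.symm)

lemma pull_flip {W : Type*} (G : Digraph V) {f : W → V} (hf : Function.Injective f) (a b : W) :
    pull f (flip G (f a) (f b)) = flip (pull f G) a b := by
  ext x y
  simp [pull, flip, hf.eq_iff]

lemma pull_flip_of_notMem_range {W : Type*} (G : Digraph V) {f : W → V} {i j : V}
    (h : ¬ (i ∈ Set.range f ∧ j ∈ Set.range f)) : pull f (flip G i j) = pull f G := by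
  ext x y
  refine flip_adj_of_ne ?_ ?_
  · rintro ⟨rfl, rfl⟩; exact h ⟨⟨x, rfl⟩, ⟨y, rfl⟩⟩
  · rintro ⟨rfl, rfl⟩; exact h ⟨⟨y, rfl⟩, ⟨x, rfl⟩⟩

/-- Carries the hypothesis through the induction: flippability restricts to quadruples containing
the edge, and other quadruples do not see the flip. -/
lemma Flippable.locallyEquivalent {G : Digraph V} (hG : IsDAG G) {i j : V}
    (h : Flippable G i j) : LocallyEquivalent (flip G i j) G := by
  intro f hf
  by_cases hij : i ∈ Set.range f ∧ j ∈ Set.range f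
  · obtain ⟨⟨a, rfl⟩, ⟨b, rfl⟩⟩ := hij
    rw [pull_flip G hf]
    exact model_flip (hG.pull hf) (h.pull hf)
  · rw [pull_flip_of_notMem_range G hij]

lemma injective_four {i j k l : V} (hij : i ≠ j) (hik : i ≠ k) (hil : i ≠ l) (hjk : j ≠ k)
    (hjl : j ≠ l) (hkl : k ≠ l) : Function.Injective ![i, j, k, l] := by
  intro a b
  fin_cases a <;> fin_cases b <;> simp [*, Ne.symm, Ne.symm hij, Ne.symm hik, Ne.symm hil,
    Ne.symm hjk, Ne.symm hjl, Ne.symm hkl]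

variable [Fintype V] [DecidableEq V]

lemma exists_fourth (hV : 4 ≤ Fintype.card V) (i j k : V) : ∃ l, l ≠ i ∧ l ≠ j ∧ l ≠ k := by
  have h : ({i, j, k} : Finset V).card < (Finset.univ : Finset V).card :=
    lt_of_le_of_lt Finset.card_le_three (by rw [Finset.card_univ]; omega)
  obtain ⟨l, -, hl⟩ := Finset.exists_mem_notMem_of_card_lt_card h
  exact ⟨l, by simpa using hl⟩

lemma LocallyEquivalent.adj (hV : 4 ≤ Fintype.card V) {G₁ G₂ : Digraph V} (h₁ : IsDAG G₁)
    (h : LocallyEquivalent G₁ G₂) {i j : V} (hij : i ≠ j) (hadj : G₁.Adj i j) :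
    G₂.Adj i j ∨ G₂.Adj j i := by
  by_contra hno
  push Not at hno
  obtain ⟨k, hki, hkj, -⟩ := exists_fourth hV i j j
  obtain ⟨l, hli, hlj, hlk⟩ := exists_fourth hV i j k
  have hf := injective_four hij hki.symm hli.symm hkj.symm hlj.symm hlk.symm
  have hmem := mem_model_of_edge (H := pull ![i, j, k, l] G₁) (fun a => h₁.1 _) hadj
  rw [h _ hf] at hmem
  exact not_mem_model_edge_nonedge hno.1 hno.2 hmem

/-- The orientation of an edge in an induced path of length two is determined. -/
lemma LocallyEquivalent.adj_of_path (hV : 4 ≤ Fintype.card V) {G₁ G₂ : Digraph V}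
    (h₁ : IsDAG G₁) (h₂ : IsDAG G₂) (h : LocallyEquivalent G₁ G₂) {i k j : V}
    (hik : i ≠ k) (hkj : k ≠ j) (hij : i ≠ j) (n1 : ¬ G₁.Adj i j) (n2 : ¬ G₁.Adj j i)
    (hadj : G₁.Adj i k ∨ G₁.Adj k i) (hkj1 : G₁.Adj k j) : G₂.Adj k j := by
  by_contra hno
  have hjk2 : G₂.Adj j k := (h.adj hV h₁ hkj hkj1).resolve_left hno
  have n3 : ¬ G₂.Adj i j := fun h' => (h.symm.adj hV h₂ hij h').elim n1 n2
  have n4 : ¬ G₂.Adj j i := fun h' => (h.symm.adj hV h₂ hij.symm h').elim n2 n1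
  have hadj2 : G₂.Adj i k ∨ G₂.Adj k i := by
    rcases hadj with h' | h'
    · exact h.adj hV h₁ hik h'
    · exact (h.adj hV h₁ hik.symm h').symm
  obtain ⟨l, hli, hlk, hlj⟩ := exists_fourth hV i k j
  have hf := injective_four hik hij hli.symm hkj hlk.symm hlj.symm
  have key := h _ hf
  have hl : ∀ a, (pull ![i, k, j, l] G₁).Adj a a := fun a => h₁.1 _
  rcases hadj with h3 | h3
  · have hmem := mem_model_of_chain (H := pull ![i, k, j, l] G₁) hl h3 hkj1
    rw [key] at hmem
    rcases hadj2 with h4 | h4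
    · exact not_mem_model_chain_collider (h₂.asymm hik h4) hno n3 n4 hmem
    · exact not_mem_model_chain_reversed_chain (h₂.asymm hik.symm h4) hno n3 n4 hmem
  · have hmem := mem_model_of_fork (H := pull ![i, k, j, l] G₁) hl h3 hkj1
    rw [key] at hmem
    rcases hadj2 with h4 | h4
    · exact not_mem_model_fork_collider (h₂.asymm hik h4) hno n3 n4 hmem
    · exact not_mem_model_fork_reversed_chain (h₂.asymm hik.symm h4) hno n3 n4 hmem

/-- If `G₂` reversed the edge, `adj_of_path` with the two graphs exchanged would reverse it in `G₁`
too. -/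
lemma LocallyEquivalent.adj_of_path' (hV : 4 ≤ Fintype.card V) {G₁ G₂ : Digraph V}
    (h₁ : IsDAG G₁) (h₂ : IsDAG G₂) (h : LocallyEquivalent G₁ G₂) {i k j : V}
    (hik : i ≠ k) (hkj : k ≠ j) (hij : i ≠ j) (n1 : ¬ G₁.Adj i j) (n2 : ¬ G₁.Adj j i)
    (hadj : G₁.Adj i k ∨ G₁.Adj k i) (hjk1 : G₁.Adj j k) : G₂.Adj j k := by
  refine (h.adj hV h₁ hkj.symm hjk1).resolve_right fun hkj2 => h₁.asymm hkj.symm hjk1 ?_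
  refine h.symm.adj_of_path hV h₂ h₁ hik hkj hij ?_ ?_ ?_ hkj2
  · exact fun h' => (h.symm.adj hV h₂ hij h').elim n1 n2
  · exact fun h' => (h.symm.adj hV h₂ hij.symm h').elim n2 n1
  · rcases hadj with h' | h'
    · exact h.adj hV h₁ hik h'
    · exact (h.adj hV h₁ hik.symm h').symm

end Local_equivalence
end Lyapunov

namespace Lyapunov

/-! ### Finding a flippable reversed edge, and the induction. -/

section Reversed_edges

/-- `i → j` is an edge of `G₁` and `j → i` is an edge of `G₂`. -/
structure Reversed {V : Type*} (G₁ G₂ : Digraph V) (i j : V) : Prop where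
  ne : i ≠ j
  left : G₁.Adj i j
  right : G₂.Adj j i

lemma Reversed.edges_flip_diff {V : Type*} {G₁ G₂ : Digraph V} {i j : V}
    (hr : Reversed G₁ G₂ i j) :
    edges (flip G₁ i j) \ edges G₂ = (edges G₁ \ edges G₂) \ {(i, j)} := by
  ext ⟨a, b⟩
  simp only [edges, Set.mem_sdiff, Set.mem_ofPred_eq, Set.mem_singleton_iff, Prod.mk.injEq]
  constructor
  · rintro ⟨h1 | ⟨rfl, rfl⟩, h2⟩
    · exact ⟨⟨h1.1, h2⟩, h1.2⟩
    · exact absurd hr.right h2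
  · rintro ⟨⟨h1, h2⟩, h3⟩
    exact ⟨Or.inl ⟨h1, h3⟩, h2⟩

variable {V : Type*} [Fintype V] [DecidableEq V] {G₁ G₂ : Digraph V} {i j : V}

/-- The endpoints of a reversed edge have the same neighbours. -/
lemma Reversed.adj_right_of_adj_left (hr : Reversed G₁ G₂ i j) (hV : 4 ≤ Fintype.card V)
    (h₁ : IsDAG G₁) (h₂ : IsDAG G₂) (h : LocallyEquivalent G₁ G₂) {k : V} (hki : k ≠ i)
    (hkj : k ≠ j) (hk : G₁.Adj k i ∨ G₁.Adj i k) : G₁.Adj k j ∨ G₁.Adj j k := by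
  by_contra hno
  push Not at hno
  exact h₂.asymm hr.ne.symm hr.right
    (h.adj_of_path hV h₁ h₂ hki hr.ne hkj hno.1 hno.2 hk hr.left)

lemma Reversed.adj_left_of_adj_right (hr : Reversed G₁ G₂ i j) (hV : 4 ≤ Fintype.card V)
    (h₁ : IsDAG G₁) (h₂ : IsDAG G₂) (h : LocallyEquivalent G₁ G₂) {k : V} (hki : k ≠ i)
    (hkj : k ≠ j) (hk : G₁.Adj k j ∨ G₁.Adj j k) : G₁.Adj k i ∨ G₁.Adj i k := by
  by_contra hno
  push Not at hno
  exact h₂.asymm hr.ne.symm hr.right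
    (h.adj_of_path' hV h₁ h₂ hkj hr.ne.symm hki hno.1 hno.2 hk hr.left)

/-- A reversed edge bridged by a directed path of length two contains a shorter one. -/
lemma Reversed.not_between (hr : Reversed G₁ G₂ i j) (hV : 4 ≤ Fintype.card V)
    (h₁ : IsDAG G₁) (h₂ : IsDAG G₂) (h : LocallyEquivalent G₁ G₂)
    (hmin : ∀ a b, Reversed G₁ G₂ a b → level G₁ j - level G₁ i ≤ level G₁ b - level G₁ a)
    {k : V} (hki : k ≠ i) (hkj : k ≠ j) (hik : G₁.Adj i k) : ¬ G₁.Adj k j := by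
  intro hkj'
  have l1 := level_lt h₁ hki.symm hik
  have l2 := level_lt h₁ hkj hkj'
  rcases h.adj hV h₁ hki.symm hik with h3 | h3
  · rcases h.adj hV h₁ hkj hkj' with h4 | h4
    · exact h₂.not_triangle hki.symm hkj h3 h4 hr.right
    · have := hmin k j ⟨hkj, hkj', h4⟩
      omega
  · have := hmin i k ⟨hki.symm, hik, h3⟩
    omega

/-- Minimality enters only in identifying parents and children. A failure of any other condition
creates induced paths of length two whose edges keep their orientation in `G₂`, so the four-vertex
subgraph of `G₂` lacks the edges that its covariance would need. -/
lemma Reversed.flippable (hr : Reversed G₁ G₂ i j) (hV : 4 ≤ Fintype.card V)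
    (h₁ : IsDAG G₁) (h₂ : IsDAG G₂) (h : LocallyEquivalent G₁ G₂)
    (hmin : ∀ a b, Reversed G₁ G₂ a b → level G₁ j - level G₁ i ≤ level G₁ b - level G₁ a) :
    Flippable G₁ i j := by
  have hpa : ∀ k, k ≠ i → k ≠ j → (G₁.Adj k i ↔ G₁.Adj k j) := by
    intro k hki hkj
    constructor
    · intro hk
      refine (hr.adj_right_of_adj_left hV h₁ h₂ h hki hkj (Or.inl hk)).resolve_right fun hjk => ?_
      exact h₁.not_triangle hki hr.ne hk hr.left hjk
    · intro hk
      refine (hr.adj_left_of_adj_right hV h₁ h₂ h hki hkj (Or.inl hk)).resolve_right fun hik => ?_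
      exact hr.not_between hV h₁ h₂ h hmin hki hkj hik hk
  have hch : ∀ k, k ≠ i → k ≠ j → (G₁.Adj i k ↔ G₁.Adj j k) := by
    intro k hki hkj
    constructor
    · intro hk
      refine (hr.adj_right_of_adj_left hV h₁ h₂ h hki hkj (Or.inr hk)).resolve_left fun hkj' => ?_
      exact hr.not_between hV h₁ h₂ h hmin hki hkj hk hkj'
    · intro hk
      refine (hr.adj_left_of_adj_right hV h₁ h₂ h hki hkj (Or.inr hk)).resolve_left fun hki' => ?_
      exact h₁.not_triangle hki hr.ne hki' hr.left hk
  have nij : ¬ G₂.Adj i j := h₂.asymm hr.ne.symm hr.right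
  have hl : ∀ f : Fin 4 → V, ∀ a, (pull f G₁).Adj a a := fun f a => h₁.1 _
  have nonadj : ∀ a b, a ≠ b → ¬ G₁.Adj a b → ¬ G₁.Adj b a → ¬ G₂.Adj a b ∧ ¬ G₂.Adj b a :=
    fun a b hab n1 n2 => ⟨fun h' => (h.symm.adj hV h₂ hab h').elim n1 n2,
      fun h' => (h.symm.adj hV h₂ hab.symm h').elim n2 n1⟩
  refine ⟨hr.ne, hr.left, hpa, hch, ?_, ?_, ?_⟩
  · intro p c hpi hpj hci hcj hp hc
    by_contra hpc
    have hpne : p ≠ c := by rintro rfl; exact h₁.asymm hpi hp hc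
    have hcp : ¬ G₁.Adj c p := fun hcp => h₁.not_triangle hpi hci.symm hp hc hcp
    have hp' := (hpa p hpi hpj).mp hp
    have hc' := (hch c hci hcj).mp hc
    obtain ⟨n1, n2⟩ := nonadj p c hpne hpc hcp
    have hf := injective_four hr.ne hpi.symm hci.symm hpj.symm hcj.symm hpne
    have hmem := mem_model_of_parent_child (H := pull ![i, j, p, c] G₁) (hl _) hr.left hp hp' hc hc'
    rw [h _ hf] at hmem
    refine not_mem_model_parent_child_flip nij ?_ ?_ n1 ?_ ?_ n2 hmem
    -- `p – i – c` and `p – j – c` are induced paths, so all four of their edges are oriented alike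
    -- in both graphs.
    · exact h₂.asymm hpi
        (h.adj_of_path' hV h₁ h₂ hci hpi.symm hpne.symm hcp hpc (Or.inr hc) hp)
    · exact h₂.asymm hpj
        (h.adj_of_path' hV h₁ h₂ hcj hpj.symm hpne.symm hcp hpc (Or.inr hc') hp')
    · exact h₂.asymm hci.symm (h.adj_of_path hV h₁ h₂ hpi hci.symm hpne hpc hcp (Or.inl hp) hc)
    · exact h₂.asymm hcj.symm (h.adj_of_path hV h₁ h₂ hpj hcj.symm hpne hpc hcp (Or.inl hp') hc')
  · intro p r hpi hpj hri hrj hp n1 n2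
    have hp' := (hpa p hpi hpj).mp hp
    have n3 : ¬ G₁.Adj r j := fun h' => n1 ((hpa r hri hrj).mpr h')
    have n4 : ¬ G₁.Adj j r := fun h' => n2 ((hch r hri hrj).mpr h')
    have hpr : p ≠ r := by rintro rfl; exact n1 hp
    obtain ⟨m1, m2⟩ := nonadj r i hri n1 n2
    obtain ⟨m3, m4⟩ := nonadj r j hrj n3 n4
    have hf := injective_four hr.ne hpi.symm hri.symm hpj.symm hrj.symm hpr
    have hip : G₁.Adj p r ∨ G₁.Adj r p → ¬ G₂.Adj i p := fun hpr' =>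
      h₂.asymm hpi (h.adj_of_path hV h₁ h₂ hpr.symm hpi hri n1 n2 hpr'.symm hp)
    have hjp : G₁.Adj p r ∨ G₁.Adj r p → ¬ G₂.Adj j p := fun hpr' =>
      h₂.asymm hpj (h.adj_of_path hV h₁ h₂ hpr.symm hpj hrj n3 n4 hpr'.symm hp')
    constructor
    · intro hpr'
      have hmem := mem_model_of_parent_fork (H := pull ![i, j, p, r] G₁) (hl _) hr.left hp hp' hpr'
      rw [h _ hf] at hmem
      refine not_mem_model_parent_fork_flip nij (hip (Or.inl hpr')) m2 (hjp (Or.inl hpr')) m4 m1 m3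
        ?_ hmem
      exact h₂.asymm hpr (h.adj_of_path hV h₁ h₂ hpi.symm hpr hri.symm n2 n1 (Or.inr hp) hpr')
    · intro hrp
      have hmem := mem_model_of_grandparent (H := pull ![i, j, p, r] G₁) (hl _) hr.left hp hp' hrp
      rw [h _ hf] at hmem
      refine not_mem_model_grandparent_flip nij (hip (Or.inr hrp)) m2 (hjp (Or.inr hrp)) m4 ?_ m1 m3
        hmem
      exact h₂.asymm hpr.symm
        (h.adj_of_path' hV h₁ h₂ hpi.symm hpr hri.symm n2 n1 (Or.inr hp) hrp)
  · intro c r hci hcj hri hrj hc n1 n2 hcr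
    have hc' := (hch c hci hcj).mp hc
    have n3 : ¬ G₁.Adj r j := fun h' => n1 ((hpa r hri hrj).mpr h')
    have n4 : ¬ G₁.Adj j r := fun h' => n2 ((hch r hri hrj).mpr h')
    have hcne : c ≠ r := by rintro rfl; exact n2 hc
    obtain ⟨m1, m2⟩ := nonadj r i hri n1 n2
    obtain ⟨m3, m4⟩ := nonadj r j hrj n3 n4
    have hf := injective_four hr.ne hci.symm hri.symm hcj.symm hrj.symm hcne
    have hmem := mem_model_of_child_chain (H := pull ![i, j, c, r] G₁) (hl _) hr.left hc hc' hcr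
    rw [h _ hf] at hmem
    refine not_mem_model_child_chain_flip nij m2 m4 ?_ ?_ m1 m3 hmem
    · exact h₂.asymm hci.symm
        (h.adj_of_path' hV h₁ h₂ hcne.symm hci hri n1 n2 (Or.inr hcr) hc)
    · exact h₂.asymm hcj.symm
        (h.adj_of_path' hV h₁ h₂ hcne.symm hcj hrj n3 n4 (Or.inr hcr) hc')

/-- With equal skeletons, an extra edge of `G₂` would be reversed in `G₁`, and then `G₂` would
contain both directions. -/
lemma eq_of_edges_diff_eq_empty (hV : 4 ≤ Fintype.card V) (h₁ : IsDAG G₁) (h₂ : IsDAG G₂)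
    (h : LocallyEquivalent G₁ G₂) (he : edges G₁ \ edges G₂ = ∅) : G₁ = G₂ := by
  have hle : ∀ a b, G₁.Adj a b → G₂.Adj a b := fun a b hab =>
    Set.sdiff_eq_empty.mp he (show (a, b) ∈ edges G₁ from hab)
  ext a b
  refine ⟨hle a b, fun hab => ?_⟩
  by_cases hne : a = b
  · subst hne; exact h₁.1 a
  · exact (h.symm.adj hV h₂ hne hab).resolve_right fun hba => h₂.asymm hne hab (hle b a hba)

lemma exists_flippable_reversed (hV : 4 ≤ Fintype.card V) (h₁ : IsDAG G₁) (h₂ : IsDAG G₂)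
    (h : LocallyEquivalent G₁ G₂) (he : (edges G₁ \ edges G₂).Nonempty) :
    ∃ i j, Flippable G₁ i j ∧ Reversed G₁ G₂ i j := by
  obtain ⟨⟨a, b⟩, hab1, hab2⟩ := he
  have hne : a ≠ b := by rintro rfl; exact hab2 (h₂.1 a)
  have hr : Reversed G₁ G₂ a b := ⟨hne, hab1, (h.adj hV h₁ hne hab1).resolve_left hab2⟩
  -- Levels increase along edges of `G₁`, so the truncated subtraction is the true difference.
  obtain ⟨⟨i, j⟩, hij, hmin⟩ := Set.exists_min_image {e : V × V | Reversed G₁ G₂ e.1 e.2}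
    (fun e => level G₁ e.2 - level G₁ e.1) (Set.toFinite _) ⟨(a, b), hr⟩
  exact ⟨i, j, hij.flippable hV h₁ h₂ h fun a b hab => hmin (a, b) hab, hij⟩

lemma TransformsInFlips.cons {n : ℕ} {G G' G'' : Digraph V} (hG : IsDAG G)
    (hflip : IsSuperCoveredFlip G G') (h : TransformsInFlips n G' G'') :
    TransformsInFlips (n + 1) G G'' := by
  obtain ⟨H, h0, hn, hdag, hstep⟩ := h
  refine ⟨Fin.cons G H, rfl, ?_, ?_, ?_⟩
  · rw [← Fin.succ_last, Fin.cons_succ, hn]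
  · intro t
    refine Fin.cases hG (fun t => ?_) t
    exact hdag t
  · intro t
    refine Fin.cases ?_ (fun t => ?_) t
    · simpa [h0] using hflip
    · rw [Fin.cons_succ, ← Fin.succ_castSucc, Fin.cons_succ]
      exact hstep t

lemma transformsInFlips_and_model_eq (hV : 4 ≤ Fintype.card V) (h₂ : IsDAG G₂) (n : ℕ)
    (h₁ : IsDAG G₁) (h : LocallyEquivalent G₁ G₂) (hn : (edges G₁ \ edges G₂).ncard = n) :
    TransformsInFlips n G₁ G₂ ∧ model G₁ = model G₂ := by
  induction n generalizing G₁ with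
  | zero =>
    have he := (Set.ncard_eq_zero (Set.toFinite _)).mp hn
    obtain rfl := eq_of_edges_diff_eq_empty hV h₁ h₂ h he
    exact ⟨⟨fun _ => G₁, rfl, rfl, fun _ => h₁, fun t => t.elim0⟩, rfl⟩
  | succ n ih =>
    have he : (edges G₁ \ edges G₂).Nonempty := by
      rw [← Set.ncard_pos (Set.toFinite _)]; omega
    obtain ⟨i, j, hf, hr⟩ := exists_flippable_reversed hV h₁ h₂ h he
    have hcard : (edges (flip G₁ i j) \ edges G₂).ncard = n := by
      rw [hr.edges_flip_diff, Set.ncard_sdiff_singleton_of_mem, hn, Nat.add_sub_cancel]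
      exact ⟨hr.left, h₂.asymm hr.ne.symm hr.right⟩
    -- The flipped graph is still a DAG locally equivalent to `G₂`, with one differing edge fewer.
    obtain ⟨ht, hm⟩ := ih (isDAG_flip h₁ hf)
      (fun f hinj => (hf.locallyEquivalent h₁ f hinj).trans (h f hinj)) hcard
    exact ⟨ht.cons h₁ ⟨h₁, i, j, hf.isSuperCovered h₁, rfl⟩, by rw [← model_flip h₁ hf, hm]⟩

lemma skeleton_le (hV : 4 ≤ Fintype.card V) (h₁ : IsDAG G₁) (h : LocallyEquivalent G₁ G₂) :
    skeleton G₁ ≤ skeleton G₂ := by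
  rintro a b ⟨hne, hab | hba⟩
  · exact ⟨hne, h.adj hV h₁ hne hab⟩
  · exact ⟨hne, (h.adj hV h₁ hne.symm hba).symm⟩

end Reversed_edges

end Lyapunov

theorem mainTheorem4 {V : Type*} [Fintype V] [DecidableEq V] (hV : 4 ≤ Fintype.card V)
    (G₁ G₂ : Digraph V) (h₁ : Lyapunov.IsDAG G₁) (h₂ : Lyapunov.IsDAG G₂)
    (hK : ∀ K : Finset V, K.card = 4 →
      Lyapunov.model (Lyapunov.induce G₁ K) = Lyapunov.model (Lyapunov.induce G₂ K)) :
    Lyapunov.skeleton G₁ = Lyapunov.skeleton G₂ ∧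
    Lyapunov.TransformsInFlips (Lyapunov.edges G₁ \ Lyapunov.edges G₂).ncard G₁ G₂ ∧
    Lyapunov.model G₁ = Lyapunov.model G₂ := by
  have h := Lyapunov.locallyEquivalent_of_induce hK
  exact ⟨le_antisymm (Lyapunov.skeleton_le hV h₁ h) (Lyapunov.skeleton_le hV h₂ h.symm),
    Lyapunov.transformsInFlips_and_model_eq hV h₂ _ h₁ h rfl⟩
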